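/- Let $\mathfrak g$ be a finite-dimensional simple Lie algebra over $\mathbb C$ with Cartan subalgebra $\mathfrak h$, root system $\Phi\subset\mathfrak h^*$, simple roots $\alpha_1,\dots,\alpha_r$, positive roots $\Phi^+$, $\rho=\frac12\sum_{\alpha\in\Phi^+}\alpha$, and Weyl group $W$ generated by the simple reflections $s_1,\dots,s_r$. A weight $\lambda\in\mathfrak h^*$ is integral if $2(\lambda,\alpha)/(\alpha,\alpha)\in\mathbb Z$ for all $\alpha\in\Phi$, and dominant if $(\lambda,\alpha)\ge 0$ for all $\alpha\in\Phi^+$. Write $\nu\le\mu$ if $\mu-\nu$ is a linear combination of positive roots with nonnegative real coefficients. Let $\wp(\xi)$ be the number of ways to write $\xi$ as a linear combination of positive roots with nonnegative integer coefficients, and let $$\mathcal A(\lambda,\mu)=\{\sigma\in W:\ \wp(\sigma(\lambda+\rho)-\mu-\rho)>0\}.$$ For $\sigma\in W$ let the influence $I(\sigma)$ be the set of $i$ such that $s_i$ occurs in a reduced word for $\sigma$, and let $\overline I(\sigma)$ consist of $I(\sigma)$ and all $i$ adjacent in the Dynkin diagram to an element of $I(\sigma)$; the influence is connected if it induces a connected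 subgraph of the Dynkin diagram. Elements $\sigma,\tau$ are independent if $I(\sigma)\cap\overline I(\tau)=\emptyset$, and a subset of $W$ is pairwise independent if any two distinct elements of it are independent. For $\lambda$ dominant integral and $\mu$ integral, $\mathrm{BAS}(\lambda,\mu)$ denotes the unique subset $S\subseteq\mathcal A(\lambda,\mu)$ with $1\notin S$ such that each $b\in S$ has connected influence and each $\sigma\in\mathcal A(\lambda,\mu)$ is the product of the elements of some (possibly empty) pairwise independent subset of $S$, each element being used exactly once (so $\mathrm{BAS}(\lambda,\mu)=\emptyset$ if $\mathcal A(\lambda,\mu)=\emptyset$). **Proposition.** Let $\lambda$ be a dominant integral weight and let $\mu,\nu$ be integral weights with $\nu\le\mu$. Assume that $\mu-\nu$ lies in the root lattice or that $\mathcal A(\lambda,\nu)\neq\emptyset$. Then there is exactly one set $S$ as above for the pair $(\lambda,\mu)$ and exactly one for the pair $(\lambda,\nu)$, so that $\mathrm{BAS}(\lambda,\mu)$ and $\mathrm{BAS}(\lambda,\nu)$ are well defined, and $$\mathrm{BAS}(\lambda,\mu)=\mathrm{BAS}(\lambda,\nu)\cap\mathcal A(\lambda,\mu).$$ -/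

import Mathlib

namespace WeylAlternation

noncomputable section

variable {ι M N : Type*} [Fintype ι] [AddCommGroup M] [Module ℂ M] [AddCommGroup N] [Module ℂ N]
  {P : RootPairing ι ℂ M N}

/-! Throughout, `b` is a base (a choice of simple roots `α_i`, `i ∈ b.support`) of a root system `P`
with finitely many roots `P.root i`, `i : ι`; the weight space is `M`. -/

/-- The weight `x` is integral: `⟨x, α^∨⟩ = 2 (x, α) / (α, α)` is an integer for every root `α`. -/
def IsIntegral (P : RootPairing ι ℂ M N) (x : M) : Prop :=
  ∀ i : ι, ∃ z : ℤ, P.toLinearMap x (P.coroot i) = (z : ℂ)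

/-- The weight `x` is dominant: `⟨x, α^∨⟩ = 2 (x, α) / (α, α)` is real and nonnegative for every
positive root `α`. -/
def IsDominant (b : P.Base) (x : M) : Prop :=
  ∀ i : ι, b.IsPos i → ∃ r : ℝ, 0 ≤ r ∧ P.toLinearMap x (P.coroot i) = (r : ℂ)

open Classical in
/-- `LowerEq b x y` is the order `x ≤ y` on weights: `y - x` is a linear combination of positive
roots with nonnegative real coefficients. -/
def LowerEq (b : P.Base) (x y : M) : Prop :=
  ∃ c : {i : ι // b.IsPos i} → ℝ, (∀ i, 0 ≤ c i) ∧ y - x = ∑ i, (c i : ℂ) • P.root i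

/-- The root lattice: all integer linear combinations of roots. -/
def rootLattice (P : RootPairing ι ℂ M N) : AddSubgroup M :=
  AddSubgroup.closure (Set.range P.root)

open Classical in
/-- `ρ`, half the sum of the positive roots. -/
def rho (b : P.Base) : M :=
  (2 : ℂ)⁻¹ • ∑ i : {i : ι // b.IsPos i}, P.root i

open Classical in
/-- Kostant's partition function: the number of ways to write the weight `x` as a linear
combination of the positive roots with coefficients in `ℕ`. -/
def kostant (b : P.Base) (x : M) : ℕ∞ :=
  ENat.card {c : {i : ι // b.IsPos i} → ℕ // ∑ i, c i • P.root i = x}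

/-- The Weyl alternation set `A(lam, mu)`. -/
def altSet (b : P.Base) (lam mu : M) : Set P.weylGroup :=
  {σ | 0 < kostant b (σ • (lam + rho b) - mu - rho b)}

/-- The simple reflection `s_i`. -/
def simpleRefl (b : P.Base) (i : b.support) : P.weylGroup :=
  RootPairing.weylGroup.ofIdx P i

/-- The product `s_{i₁} s_{i₂} ⋯ s_{iₖ}` of a word in the simple reflections. -/
def wordProd (b : P.Base) (ω : List b.support) : P.weylGroup :=
  (ω.map (simpleRefl b)).prod

/-- `ω` is a reduced word for `σ`: a word of minimal length with product `σ`. -/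
def IsReducedWord (b : P.Base) (ω : List b.support) (σ : P.weylGroup) : Prop :=
  wordProd b ω = σ ∧ ∀ ω' : List b.support, wordProd b ω' = σ → ω.length ≤ ω'.length

/-- The underlying graph of the Dynkin diagram: simple roots are the vertices, and two of them are
adjacent when they are distinct and not orthogonal. -/
def dynkinGraph (b : P.Base) : SimpleGraph b.support where
  Adj i j := i ≠ j ∧ ¬ P.IsOrthogonal i j
  symm := ⟨fun _ _ h => ⟨h.1.symm, fun h' => h.2 h'.symm⟩⟩
  loopless := ⟨fun _ h => h.1 rfl⟩

/-- The influence `I(σ)`. -/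
def influence (b : P.Base) (σ : P.weylGroup) : Set b.support :=
  {i | ∃ ω : List b.support, IsReducedWord b ω σ ∧ i ∈ ω}

/-- The extended influence of `σ`: its influence together with all neighbours in the Dynkin
diagram. -/
def extInfluence (b : P.Base) (σ : P.weylGroup) : Set b.support :=
  {i | i ∈ influence b σ ∨ ∃ j ∈ influence b σ, (dynkinGraph b).Adj i j}

/-- `σ` has connected influence: `I(σ)` induces a connected subgraph of the Dynkin diagram. -/
def HasConnectedInfluence (b : P.Base) (σ : P.weylGroup) : Prop :=
  ((dynkinGraph b).induce (influence b σ)).Connected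

/-- `σ` and `τ` are independent. -/
def Independent (b : P.Base) (σ τ : P.weylGroup) : Prop :=
  influence b σ ∩ extInfluence b τ = ∅

/-- Any two distinct elements of `B` are independent. -/
def PairwiseIndependent (b : P.Base) (B : Set P.weylGroup) : Prop :=
  ∀ σ ∈ B, ∀ τ ∈ B, σ ≠ τ → Independent b σ τ

/-- `S` has the defining properties of the set of basic allowable subwords of `(lam, mu)`. The list
`L` enumerates, without repetition, a (possibly empty) pairwise independent subset of `S`. -/
structure IsBAS (b : P.Base) (lam mu : M) (S : Set P.weylGroup) : Prop where
  subset : S ⊆ altSet b lam mu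
  one_notMem : (1 : P.weylGroup) ∉ S
  connected : ∀ σ ∈ S, HasConnectedInfluence b σ
  exists_prod : ∀ σ ∈ altSet b lam mu, ∃ L : List P.weylGroup,
    L.Nodup ∧ (∀ τ ∈ L, τ ∈ S) ∧ PairwiseIndependent b {τ | τ ∈ L} ∧ L.prod = σ

open Classical in
/-- `BAS(lam, mu)`: the unique set with the properties `IsBAS` (with the default value `∅` if there
were no unique such set). -/
def BAS (b : P.Base) (lam mu : M) : Set P.weylGroup :=
  if h : ∃! S, IsBAS b lam mu S then h.choose else ∅

end

end WeylAlternation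

namespace WeylAlternation

variable {ι M N : Type*} [AddCommGroup M] [Module ℂ M] [AddCommGroup N] [Module ℂ N]
  {P : RootPairing ι ℂ M N}

/-! ### The action of the Weyl group -/

/-! The set `BAS b lam mu` is simply the set of elements of `altSet b lam mu` with connected
influence (`BAS_eq`), so the claim reduces to `altSet b lam mu ⊆ altSet b lam nu`
(`altSet_subset_of_lowerEq`).

Everything rests on the displacement `x - σ • x` of `x = lam + rho b`. Its coefficients in the
simple roots are natural numbers, nonzero exactly at the letters of a reduced word for `σ`
(`IsReducedWord.repr_displacement`). Displacements of independent elements add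
(`Independent.displacement_mul`), and `σ ∈ altSet b lam mu` means that `x - mu - rho b` minus the
displacement has natural coefficients. Hence independent factors of an element of the alternation
set again lie in it.

Existence of the set: split each element along the connected components of its influence
(`exists_factorization`). Uniqueness: an element with connected influence is not a product of two
nontrivial independent elements (`HasConnectedInfluence.eq_one_of_independent`), so it must itself
belong to the set. -/

lemma weylGroup_ext {σ τ : P.weylGroup} (h : ∀ x : M, σ • x = τ • x) : σ = τ :=
  Subtype.ext <| RootPairing.Equiv.weightHom_injective P <| LinearEquiv.ext h

lemma smul_root (σ : P.weylGroup) (i : ι) : σ • P.root i = P.root (σ • i) :=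
  (RootPairing.Equiv.root_indexEquiv_eq_smul (P := P) (i := i) (g := σ)).symm

lemma simpleRefl_smul (b : P.Base) (i : b.support) (x : M) :
    simpleRefl b i • x = x - P.toLinearMap x (P.coroot i) • P.root i :=
  P.reflection_apply i x

lemma simpleRefl_smul_index (b : P.Base) (i : b.support) (j : ι) :
    simpleRefl b i • j = P.reflectionPerm i j := rfl

@[simp]
lemma simpleRefl_mul_self (b : P.Base) (i : b.support) : simpleRefl b i * simpleRefl b i = 1 :=
  weylGroup_ext fun x ↦ by
    rw [mul_smul, one_smul]
    exact P.reflection_same i x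

@[simp]
lemma simpleRefl_mul_cancel_left (b : P.Base) (i : b.support) (σ : P.weylGroup) :
    simpleRefl b i * (simpleRefl b i * σ) = σ := by
  rw [← mul_assoc, simpleRefl_mul_self, one_mul]

lemma commute_simpleRefl (b : P.Base) {i j : b.support} (h : P.IsOrthogonal i j) :
    Commute (simpleRefl b i) (simpleRefl b j) :=
  weylGroup_ext fun x ↦ by
    rw [mul_smul, mul_smul]
    exact LinearEquiv.congr_fun (P.isOrthogonal_comm i j h) x

lemma ofIdx_simpleRefl_smul (b : P.Base) (i : b.support) (j : ι) :
    RootPairing.weylGroup.ofIdx P (simpleRefl b i • j) =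
      simpleRefl b i * RootPairing.weylGroup.ofIdx P j * simpleRefl b i :=
  weylGroup_ext fun x ↦ by
    rw [mul_smul, mul_smul]
    exact LinearEquiv.congr_fun (P.reflection_reflectionPerm (i := j) (j := i)) x

@[simp]
lemma wordProd_nil (b : P.Base) : wordProd b [] = 1 := rfl

@[simp]
lemma wordProd_cons (b : P.Base) (i : b.support) (ω : List b.support) :
    wordProd b (i :: ω) = simpleRefl b i * wordProd b ω := by
  simp [wordProd]

@[simp]
lemma wordProd_append (b : P.Base) (ω ω' : List b.support) :
    wordProd b (ω ++ ω') = wordProd b ω * wordProd b ω' := by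
  simp [wordProd]

/-- The conjugation rule `s_{wα} = w s_α w⁻¹`, written without inverses. -/
lemma ofIdx_wordProd_smul (b : P.Base) (ω : List b.support) (j : ι) :
    RootPairing.weylGroup.ofIdx P (wordProd b ω • j) * wordProd b ω =
      wordProd b ω * RootPairing.weylGroup.ofIdx P j := by
  induction ω with
  | nil => simp
  | cons i ω ih =>
    rw [wordProd_cons, mul_smul, ofIdx_simpleRefl_smul, mul_assoc, mul_assoc,
      simpleRefl_mul_cancel_left, ih, mul_assoc]

/-- The simple reflections generate the Weyl group. -/
lemma exists_wordProd_eq [Finite ι] [P.IsCrystallographic] [P.IsReduced] (b : P.Base)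
    (σ : P.weylGroup) : ∃ ω : List b.support, wordProd b ω = σ := by
  have key (i : ι) : ∃ ω, wordProd b ω = RootPairing.weylGroup.ofIdx P i := by
    refine RootPairing.Base.induction_reflect (b := b) i (p := fun i ↦ ∃ ω, wordProd b ω =
      RootPairing.weylGroup.ofIdx P i) (fun i ⟨ω, h⟩ ↦ ⟨ω, ?_⟩) (fun i hi ↦ ⟨[⟨i, hi⟩], ?_⟩)
      (fun i j ⟨ω, h⟩ hj ↦ ⟨⟨j, hj⟩ :: (ω ++ [⟨j, hj⟩]), ?_⟩)
    · rw [h]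
      refine weylGroup_ext fun x ↦ ?_
      change P.reflection i x = P.reflection (P.reflectionPerm i i) x
      simp [RootPairing.reflection_reflectionPerm]
    · simp [simpleRefl]
    · simpa [h, mul_assoc, simpleRefl_smul_index] using (ofIdx_simpleRefl_smul b ⟨j, hj⟩ i).symm
  obtain ⟨σ, hσ⟩ := σ
  induction hσ using RootPairing.weylGroup.induction with
  | mem i => exact key i
  | one => exact ⟨[], rfl⟩
  | mul x y hx hy ihx ihy =>
    obtain ⟨ω, h⟩ := ihx
    obtain ⟨ω', h'⟩ := ihy
    exact ⟨ω ++ ω', by rw [wordProd_append, h, h']; rfl⟩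

lemma exists_isReducedWord [Finite ι] [P.IsCrystallographic] [P.IsReduced] (b : P.Base)
    (σ : P.weylGroup) : ∃ ω : List b.support, IsReducedWord b ω σ := by
  classical
  have h : ∃ n, ∃ ω : List b.support, ω.length = n ∧ wordProd b ω = σ :=
    let ⟨ω, hω⟩ := exists_wordProd_eq b σ
    ⟨_, ω, rfl, hω⟩
  obtain ⟨ω, hn, hω⟩ := Nat.find_spec h
  exact ⟨ω, hω, fun ω' h' ↦ hn ▸ Nat.find_min' h ⟨ω', rfl, h'⟩⟩

lemma IsReducedWord.of_append_left {b : P.Base} {ω ω' : List b.support} {σ : P.weylGroup}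
    (h : IsReducedWord b (ω ++ ω') σ) : IsReducedWord b ω (wordProd b ω) :=
  ⟨rfl, fun ω'' h' ↦ by simpa using h.2 (ω'' ++ ω') (by rw [wordProd_append, h', ← h.1,
    wordProd_append])⟩

lemma IsReducedWord.of_append_right {b : P.Base} {ω ω' : List b.support} {σ : P.weylGroup}
    (h : IsReducedWord b (ω ++ ω') σ) : IsReducedWord b ω' (wordProd b ω') :=
  ⟨rfl, fun ω'' h' ↦ by simpa using h.2 (ω ++ ω'') (by rw [wordProd_append, h', ← h.1,
    wordProd_append])⟩

/-- The exchange condition. -/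
lemma exists_shorter_word_of_not_isPos [Finite ι] [P.IsCrystallographic] [P.IsReduced]
    (b : P.Base) (ω : List b.support) (i : b.support) (h : ¬ b.IsPos (wordProd b ω • (i : ι))) :
    ∃ ω' : List b.support, ω'.length < ω.length ∧ wordProd b ω' = wordProd b ω * simpleRefl b i := by
  induction ω with
  | nil => exact absurd (b.isPos_of_mem_support i.2) (by simpa using h)
  | cons j ω ih =>
    by_cases hω : b.IsPos (wordProd b ω • (i : ι))
    -- `s_j` permutes the positive roots other than `α_j`, so the only positive root it can make
    -- negative is `α_j`. Then `w s_i = s_j w`, and the letter `j` cancels.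
    · have hj : wordProd b ω • (i : ι) = j := by
        by_contra hne
        rw [wordProd_cons, mul_smul] at h
        exact h (hω.reflectionPerm j.2 hne)
      refine ⟨ω, by simp, ?_⟩
      have := ofIdx_wordProd_smul b ω i
      rw [hj] at this
      change simpleRefl b j * _ = _ * simpleRefl b i at this
      rw [wordProd_cons, mul_assoc, ← this, simpleRefl_mul_cancel_left]
    · obtain ⟨ω', hlen, hω'⟩ := ih hω
      exact ⟨j :: ω', by simpa, by simp [hω', mul_assoc]⟩

lemma IsReducedWord.isPos_smul [Finite ι] [P.IsCrystallographic] [P.IsReduced] {b : P.Base}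
    {ω : List b.support} {i : b.support} {σ : P.weylGroup} (h : IsReducedWord b (ω ++ [i]) σ) :
    b.IsPos (wordProd b ω • (i : ι)) := by
  by_contra hneg
  obtain ⟨ω', hlen, hω'⟩ := exists_shorter_word_of_not_isPos b ω i hneg
  have := h.2 ω' (by rw [hω', ← h.1]; simp)
  simp at this
  omega

/-! ### Coefficients with respect to the simple roots -/

variable [P.IsRootSystem]

/-- All coefficients of the weight `x` with respect to the simple roots are natural numbers. -/
def HasNatCoeffs (b : P.Base) (x : M) : Prop :=
  ∀ k : b.support, ∃ n : ℕ, b.toWeightBasis.repr x k = (n : ℂ)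

/-- All coefficients of the weight `x` with respect to the simple roots are integers. -/
def HasIntCoeffs (b : P.Base) (x : M) : Prop :=
  ∀ k : b.support, ∃ z : ℤ, b.toWeightBasis.repr x k = (z : ℂ)

lemma HasNatCoeffs.hasIntCoeffs {b : P.Base} {x : M} (hx : HasNatCoeffs b x) :
    HasIntCoeffs b x := fun k ↦
  let ⟨n, hn⟩ := hx k
  ⟨n, by simpa using hn⟩

lemma HasNatCoeffs.zero (b : P.Base) : HasNatCoeffs b (0 : M) := fun _ ↦ ⟨0, by simp⟩

lemma HasNatCoeffs.add {b : P.Base} {x y : M} (hx : HasNatCoeffs b x) (hy : HasNatCoeffs b y) :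
    HasNatCoeffs b (x + y) := fun k ↦
  let ⟨m, hm⟩ := hx k
  let ⟨n, hn⟩ := hy k
  ⟨m + n, by simp [hm, hn]⟩

lemma HasNatCoeffs.nsmul {b : P.Base} {x : M} (hx : HasNatCoeffs b x) (m : ℕ) :
    HasNatCoeffs b (m • x) := fun k ↦
  let ⟨n, hn⟩ := hx k
  ⟨m * n, by simp [hn]⟩

lemma HasIntCoeffs.sub {b : P.Base} {x y : M} (hx : HasIntCoeffs b x) (hy : HasIntCoeffs b y) :
    HasIntCoeffs b (x - y) := fun k ↦
  let ⟨m, hm⟩ := hx k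
  let ⟨n, hn⟩ := hy k
  ⟨m - n, by simp [hm, hn]⟩

lemma repr_root [DecidableEq ι] (b : P.Base) (i k : b.support) :
    b.toWeightBasis.repr (P.root i) k = if i = k then 1 else 0 := by
  rw [b.toWeightBasis_repr_root, Finsupp.single_apply]

lemma hasNatCoeffs_root_of_mem_support (b : P.Base) (i : b.support) :
    HasNatCoeffs b (P.root i) := fun k ↦ by
  classical
  exact ⟨if i = k then 1 else 0, by rw [repr_root]; split_ifs <;> simp⟩

lemma hasNatCoeffs_root [Finite ι] [P.IsCrystallographic] {b : P.Base} {i : ι} (hi : b.IsPos i) :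
    HasNatCoeffs b (P.root i) :=
  hi.induction_on_add (p := fun i ↦ HasNatCoeffs b (P.root i))
    (fun i hi ↦ hasNatCoeffs_root_of_mem_support b ⟨i, hi⟩)
    fun _ j _ hk hi hj ↦ hk ▸ hi.add (hasNatCoeffs_root_of_mem_support b ⟨j, hj⟩)

/-- An element of the Weyl group only changes the coefficients of those simple roots whose
reflections occur in a word for it. -/
lemma repr_wordProd_smul (b : P.Base) (ω : List b.support) (x : M) {k : b.support} (hk : k ∉ ω) :
    b.toWeightBasis.repr (wordProd b ω • x) k = b.toWeightBasis.repr x k := by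
  classical
  induction ω with
  | nil => simp
  | cons i ω ih =>
    simp only [List.mem_cons, not_or] at hk
    rw [wordProd_cons, mul_smul, simpleRefl_smul, map_sub, LinearEquiv.map_smul, Finsupp.sub_apply,
      Finsupp.smul_apply, repr_root, ih hk.2]
    simp [Ne.symm hk.1]

/-! ### Displacement of a strictly dominant weight -/

/-- The weight `x` is integral and strictly dominant. -/
def IsStrictlyDominant (b : P.Base) (x : M) : Prop :=
  ∀ i : b.support, ∃ n : ℕ, n ≠ 0 ∧ P.toLinearMap x (P.coroot i) = (n : ℂ)

/-- Appending a letter `i` to a reduced word for `w` adds `c • w α_i`, where `c = ⟨x, α_i^∨⟩ > 0`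
and `w α_i` is a positive root by the exchange condition. So coefficients never decrease. -/
lemma IsReducedWord.repr_displacement [Finite ι] [P.IsCrystallographic] [P.IsReduced]
    {b : P.Base} {x : M} (hx : IsStrictlyDominant b x) {ω : List b.support} {σ : P.weylGroup}
    (h : IsReducedWord b ω σ) (k : b.support) :
    ∃ n : ℕ, b.toWeightBasis.repr (x - σ • x) k = (n : ℂ) ∧ (n ≠ 0 ↔ k ∈ ω) := by
  classical
  rw [← h.1]
  induction ω using List.reverseRecOn generalizing σ with
  | nil => exact ⟨0, by simp⟩
  | append_singleton ω i ih =>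
    obtain ⟨m, hm, hm'⟩ := ih h.of_append_left
    obtain ⟨c, hc₀, hc⟩ := hx i
    have hroot : HasNatCoeffs b (wordProd b ω • P.root i) := by
      rw [smul_root]
      exact hasNatCoeffs_root h.isPos_smul
    obtain ⟨n, hn⟩ := hroot k
    have heq : x - wordProd b (ω ++ [i]) • x =
        (x - wordProd b ω • x) + c • (wordProd b ω • P.root i) := by
      rw [wordProd_append, mul_smul, wordProd_cons, wordProd_nil, mul_one, simpleRefl_smul, hc,
        smul_sub, Nat.cast_smul_eq_nsmul, smul_comm]
      abel
    refine ⟨m + c * n, by rw [heq]; simp [hm, hn, -map_sub], ?_⟩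
    by_cases hk : k ∈ ω
    · simp [hk, hm'.2 hk]
    -- As `k` has not occurred so far, `w` does not change the `k`-th coefficient of `α_i`: it is 1
    -- if `i = k` and 0 otherwise.
    · rw [repr_wordProd_smul b ω _ hk, repr_root] at hn
      have hm₀ : m = 0 := by simpa using mt hm'.1 hk
      by_cases hik : i = k
      · have : n = 1 := by simpa [hik] using hn.symm
        simp [hik, this, hc₀]
      · have : n = 0 := by simpa [hik] using hn.symm
        simp [hk, Ne.symm hik, this, hm₀]

end WeylAlternation

namespace WeylAlternation

variable {ι M N : Type*} [AddCommGroup M] [Module ℂ M] [AddCommGroup N] [Module ℂ N]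
  {P : RootPairing ι ℂ M N}

/-! ### The weight `ρ` -/

/-- `s_i` permutes the positive roots other than `α_i`, so their sum is fixed and pairs to zero with
`α_i^∨`. Only half of `⟨α_i, α_i^∨⟩ = 2` remains. -/
lemma toLinearMap_rho_coroot [Fintype ι] [P.IsCrystallographic] [P.IsReduced] (b : P.Base)
    (i : b.support) : P.toLinearMap (rho b) (P.coroot i) = 1 := by
  classical
  have hsum : (∑ j : {j : ι // b.IsPos j}, P.root j) =
      P.root i + ∑ j ∈ (Finset.univ.filter b.IsPos).erase (i : ι), P.root j := by
    rw [Finset.add_sum_erase _ _ (by simpa using b.isPos_of_mem_support i.2)]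
    exact (Finset.sum_subtype _ (by simp) _).symm
  have hmem {j : ι} (hj : j ∈ (Finset.univ.filter b.IsPos).erase (i : ι)) :
      P.reflectionPerm i j ∈ (Finset.univ.filter b.IsPos).erase (i : ι) := by
    simp only [Finset.mem_erase, Finset.mem_filter, Finset.mem_univ, true_and] at hj ⊢
    refine ⟨fun h ↦ ?_, hj.2.reflectionPerm i.2 hj.1⟩
    have hneg : ¬ b.IsPos (P.reflectionPerm i i) := by
      let := P.indexNeg
      exact fun hpos ↦ (RootPairing.Base.IsPos.neg_iff_not b i).1 hpos
        (b.isPos_of_mem_support i.2)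
    have hji : j = P.reflectionPerm i i := by rw [← P.reflectionPerm_self i j, h]
    exact hneg (hji ▸ hj.2)
  have hfix : P.reflection i (∑ j ∈ (Finset.univ.filter b.IsPos).erase (i : ι), P.root j) =
      ∑ j ∈ (Finset.univ.filter b.IsPos).erase (i : ι), P.root j := by
    rw [map_sum]
    exact Finset.sum_bij' (fun j _ ↦ P.reflectionPerm i j) (fun j _ ↦ P.reflectionPerm i j)
      (fun _ ↦ hmem) (fun _ ↦ hmem) (by simp) (by simp) (by simp)
  rw [P.reflection_apply, sub_eq_self, smul_eq_zero, or_iff_left (P.ne_zero _)] at hfix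
  change P.toLinearMap _ _ = 0 at hfix
  rw [rho, hsum, map_smul, LinearMap.smul_apply, map_add, LinearMap.add_apply, hfix,
    P.root_coroot_two, smul_eq_mul]
  norm_num

lemma isStrictlyDominant_rho [Fintype ι] [P.IsCrystallographic] [P.IsReduced] (b : P.Base) :
    IsStrictlyDominant b (rho b) := fun i ↦ ⟨1, one_ne_zero, by simp [toLinearMap_rho_coroot]⟩

lemma isStrictlyDominant_add_rho [Fintype ι] [P.IsCrystallographic] [P.IsReduced] {b : P.Base}
    {x : M} (hint : IsIntegral P x) (hdom : IsDominant b x) :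
    IsStrictlyDominant b (x + rho b) := fun i ↦ by
  obtain ⟨z, hz⟩ := hint i
  obtain ⟨r, hr₀, hr⟩ := hdom i (b.isPos_of_mem_support i.2)
  have hzr : (z : ℝ) = r := by exact_mod_cast hz.symm.trans hr
  lift z to ℕ using by exact_mod_cast hzr ▸ hr₀
  exact ⟨z + 1, by simp, by simp [toLinearMap_rho_coroot, hz]⟩

/-! ### Influence -/

lemma isReducedWord_nil (b : P.Base) : IsReducedWord b [] 1 := ⟨rfl, by simp⟩

lemma PairwiseIndependent.of_cons {b : P.Base} {σ : P.weylGroup} {L : List P.weylGroup}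
    (h : PairwiseIndependent b {τ | τ ∈ σ :: L}) : PairwiseIndependent b {τ | τ ∈ L} :=
  fun _ hτ _ hτ' ↦ h _ (List.mem_cons_of_mem _ hτ) _ (List.mem_cons_of_mem _ hτ')

lemma independent_iff {b : P.Base} {σ τ : P.weylGroup} : Independent b σ τ ↔
    ∀ i ∈ influence b σ, ∀ j ∈ influence b τ, i ≠ j ∧ P.IsOrthogonal i j := by
  rw [Independent, Set.eq_empty_iff_forall_notMem]
  constructor
  · intro h i hi j hj
    have hij : i ≠ j := fun e ↦ h i ⟨hi, Or.inl (e ▸ hj)⟩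
    refine ⟨hij, by_contra fun ho ↦ h i ⟨hi, Or.inr ⟨j, hj, hij, ho⟩⟩⟩
  · rintro h i ⟨hi, hi' | ⟨j, hj, hadj⟩⟩
    · exact (h i hi i hi').1 rfl
    · exact hadj.2 (h i hi j hj).2

lemma independent_of_forall_mem {b : P.Base} {σ π : P.weylGroup}
    (h : ∀ j ∈ influence b π, ∃ τ, Independent b σ τ ∧ j ∈ influence b τ) : Independent b σ π :=
  independent_iff.2 fun i hi j hj ↦
    let ⟨_, hτ, hj⟩ := h j hj
    independent_iff.1 hτ i hi j hj

lemma PairwiseIndependent.independent_of_cons {b : P.Base} {σ τ : P.weylGroup}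
    {L : List P.weylGroup} (h : PairwiseIndependent b {τ | τ ∈ σ :: L}) (hσ : σ ∉ L)
    (hτ : τ ∈ L) : Independent b σ τ :=
  h σ List.mem_cons_self τ (List.mem_cons_of_mem _ hτ) fun e ↦ hσ (e ▸ hτ)

section Influence

variable [P.IsRootSystem] [Fintype ι] [P.IsCrystallographic] [P.IsReduced] {b : P.Base} {σ τ : P.weylGroup}

/-- The support of `ρ - σρ` depends on `σ` alone, so all reduced words have the same letters; braid
relations are not needed. -/
lemma IsReducedWord.mem_influence_iff {ω : List b.support} (h : IsReducedWord b ω σ)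
    (k : b.support) : k ∈ influence b σ ↔ k ∈ ω := by
  refine ⟨fun ⟨ω', h', hk⟩ ↦ ?_, fun hk ↦ ⟨ω, h, hk⟩⟩
  obtain ⟨m, hm, hm'⟩ := h.repr_displacement (isStrictlyDominant_rho b) k
  obtain ⟨n, hn, hn'⟩ := h'.repr_displacement (isStrictlyDominant_rho b) k
  rw [← hm', ← Nat.cast_injective (hn.symm.trans hm)]
  exact hn'.2 hk

lemma hasNatCoeffs_displacement {x : M} (hx : IsStrictlyDominant b x) (σ : P.weylGroup) :
    HasNatCoeffs b (x - σ • x) := fun k ↦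
  let ⟨_, hω⟩ := exists_isReducedWord b σ
  let ⟨n, hn, _⟩ := hω.repr_displacement hx k
  ⟨n, hn⟩

lemma mem_influence_iff_repr_ne_zero {x : M} (hx : IsStrictlyDominant b x) (σ : P.weylGroup)
    (k : b.support) : k ∈ influence b σ ↔ b.toWeightBasis.repr (x - σ • x) k ≠ 0 := by
  obtain ⟨ω, hω⟩ := exists_isReducedWord b σ
  obtain ⟨n, hn, hn'⟩ := hω.repr_displacement hx k
  rw [hω.mem_influence_iff, ← hn', hn, Nat.cast_ne_zero]

@[simp]
lemma influence_one (b : P.Base) : influence b 1 = ∅ :=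
  Set.eq_empty_of_forall_notMem fun k ↦ by
    simp [(isReducedWord_nil b).mem_influence_iff]

lemma influence_eq_empty_iff : influence b σ = ∅ ↔ σ = 1 := by
  refine ⟨fun h ↦ ?_, fun h ↦ h ▸ influence_one b⟩
  obtain ⟨ω, hω⟩ := exists_isReducedWord b σ
  have : ω = [] := List.eq_nil_iff_forall_not_mem.2 fun k hk ↦ by
    simpa [h] using (hω.mem_influence_iff k).2 hk
  rw [← hω.1, this, wordProd_nil]

/-- `x - στx = (x - σx) + σ(x - τx)`, and `x - τx` is a combination of simple roots in `I(τ)`. These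
are orthogonal to the letters of `σ`, hence fixed by `σ`. -/
lemma Independent.displacement_mul (h : Independent b σ τ) {x : M}
    (hx : IsStrictlyDominant b x) : x - (σ * τ) • x = (x - σ • x) + (x - τ • x) := by
  suffices hfix : σ • (x - τ • x) = x - τ • x by
    rw [← hfix, smul_sub, mul_smul]
    abel
  obtain ⟨ω, hω⟩ := exists_isReducedWord b σ
  have hσ {j : b.support} (hj : j ∈ influence b τ) : σ • P.root j = P.root j := by
    have hi {i : b.support} (hi : i ∈ ω) : P.toLinearMap (P.root j) (P.coroot i) = 0 :=
      ((independent_iff.1 h i ((hω.mem_influence_iff i).2 hi) j hj).2).2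
    rw [← hω.1]
    clear hω
    induction ω with
    | nil => simp
    | cons i ω ih =>
      rw [wordProd_cons, mul_smul, ih fun hk ↦ hi (List.mem_cons_of_mem _ hk), simpleRefl_smul,
        hi List.mem_cons_self, zero_smul, sub_zero]
  rw [← b.toWeightBasis.sum_repr (x - τ • x), Finset.smul_sum]
  refine Finset.sum_congr rfl fun j _ ↦ ?_
  rw [b.toWeightBasis_apply, smul_comm]
  by_cases hj : j ∈ influence b τ
  · rw [hσ hj]
  · rw [mem_influence_iff_repr_ne_zero hx, not_not] at hj
    rw [hj, zero_smul, zero_smul]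

lemma Independent.influence_mul (h : Independent b σ τ) :
    influence b (σ * τ) = influence b σ ∪ influence b τ := by
  have hρ := isStrictlyDominant_rho b
  ext k
  obtain ⟨m, hm⟩ := hasNatCoeffs_displacement hρ σ k
  obtain ⟨n, hn⟩ := hasNatCoeffs_displacement hρ τ k
  rw [Set.mem_union, mem_influence_iff_repr_ne_zero hρ, mem_influence_iff_repr_ne_zero hρ,
    mem_influence_iff_repr_ne_zero hρ, h.displacement_mul hρ, map_add, Finsupp.add_apply, hm, hn]
  norm_cast
  omega

lemma influence_list_prod {L : List P.weylGroup} (hL : L.Nodup)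
    (hind : PairwiseIndependent b {τ | τ ∈ L}) (k : b.support) :
    k ∈ influence b L.prod ↔ ∃ τ ∈ L, k ∈ influence b τ := by
  induction L generalizing k with
  | nil => simp
  | cons σ L ih =>
    rw [List.nodup_cons] at hL
    specialize ih hL.2 hind.of_cons
    have : Independent b σ L.prod := independent_of_forall_mem fun j hj ↦
      let ⟨τ, hτ, hj⟩ := (ih j).1 hj
      ⟨τ, hind.independent_of_cons hL.1 hτ, hj⟩
    simp [this.influence_mul, ih]

lemma independent_list_prod {σ : P.weylGroup} {L : List P.weylGroup} (hL : (σ :: L).Nodup)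
    (hind : PairwiseIndependent b {τ | τ ∈ σ :: L}) : Independent b σ L.prod :=
  independent_of_forall_mem fun j hj ↦ by
    rw [List.nodup_cons] at hL
    obtain ⟨τ, hτ, hj⟩ := (influence_list_prod hL.2 hind.of_cons j).1 hj
    exact ⟨τ, hind.independent_of_cons hL.1 hτ, hj⟩

end Influence

end WeylAlternation

namespace WeylAlternation

variable {ι M N : Type*} [AddCommGroup M] [Module ℂ M] [AddCommGroup N] [Module ℂ N]
  {P : RootPairing ι ℂ M N}

/-! ### Factorization along the connected components of the influence -/

lemma commute_simpleRefl_wordProd (b : P.Base) {i : b.support} {ω : List b.support}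
    (h : ∀ j ∈ ω, P.IsOrthogonal i j) : Commute (simpleRefl b i) (wordProd b ω) := by
  induction ω with
  | nil => exact Commute.one_right _
  | cons j ω ih =>
    rw [wordProd_cons]
    exact (commute_simpleRefl b (h j List.mem_cons_self)).mul_right
      (ih fun k hk ↦ h k (List.mem_cons_of_mem _ hk))

open Classical in
-- Letters in `C` commute with letters outside `C`, so they can be moved to the front.
lemma wordProd_filter_mul (b : P.Base) (C : Set b.support) (ω : List b.support)
    (h : ∀ i ∈ ω, i ∈ C → ∀ j ∈ ω, j ∉ C → P.IsOrthogonal i j) :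
    wordProd b (ω.filter (· ∈ C) ++ ω.filter (· ∉ C)) = wordProd b ω := by
  induction ω with
  | nil => rfl
  | cons i ω ih =>
    specialize ih fun i hi hiC j hj ↦
      h i (List.mem_cons_of_mem _ hi) hiC j (List.mem_cons_of_mem _ hj)
    rw [wordProd_append] at ih
    by_cases hi : i ∈ C
    · simp [hi, ← ih]
    · have : Commute (simpleRefl b i) (wordProd b (ω.filter (· ∈ C))) :=
        commute_simpleRefl_wordProd b fun j hj ↦ by
          rw [List.mem_filter, decide_eq_true_iff] at hj
          exact (h j (List.mem_cons_of_mem _ hj.1) hj.2 i List.mem_cons_self hi).symm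
      simp only [hi, decide_false, Bool.false_eq_true, not_false_eq_true, List.filter_cons_of_neg,
        decide_true, List.filter_cons_of_pos, wordProd_append, wordProd_cons, ← ih]
      rw [← mul_assoc, ← this.eq, mul_assoc]

variable [Fintype ι] [P.IsRootSystem] [P.IsCrystallographic] [P.IsReduced] {b : P.Base}

lemma exists_mul_eq_of_isOrthogonal (σ : P.weylGroup) (C : Set b.support)
    (h : ∀ i ∈ influence b σ, i ∈ C → ∀ j ∈ influence b σ, j ∉ C → P.IsOrthogonal i j) :
    ∃ σ₁ σ₂, σ₁ * σ₂ = σ ∧ influence b σ₁ = influence b σ ∩ C ∧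
      influence b σ₂ = influence b σ \ C := by
  classical
  obtain ⟨ω, hω⟩ := exists_isReducedWord b σ
  have hprod := wordProd_filter_mul b C ω fun i hi hiC j hj ↦
    h i ((hω.mem_influence_iff i).2 hi) hiC j ((hω.mem_influence_iff j).2 hj)
  -- Rearranging keeps the length, so the new word is reduced. Hence so are its two halves, whose
  -- letters give the influences.
  have hred : IsReducedWord b (ω.filter (· ∈ C) ++ ω.filter (· ∉ C)) σ := by
    refine ⟨hprod.trans hω.1, fun ω' h' ↦ ?_⟩
    rw [List.length_append]
    convert hω.2 ω' h' using 1
    simpa using (List.length_eq_length_filter_add (l := ω) (fun i ↦ decide (i ∈ C))).symm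
  refine ⟨_, _, (wordProd_append b _ _).symm.trans hred.1, ?_, ?_⟩
  · ext k
    rw [hred.of_append_left.mem_influence_iff, Set.mem_inter_iff, hω.mem_influence_iff]
    simp
  · ext k
    rw [hred.of_append_right.mem_influence_iff, Set.mem_sdiff, hω.mem_influence_iff]
    simp

/-- Every vertex of a finite set of vertices lies in a connected subset that has no edge to its
complement in the set. -/
lemma _root_.SimpleGraph.exists_connected_subset_not_adj {V : Type*} [Finite V] (G : SimpleGraph V)
    {s : Set V} {v : V} (hv : v ∈ s) :
    ∃ C ⊆ s, v ∈ C ∧ (G.induce C).Connected ∧ ∀ i ∈ C, ∀ j ∈ s, j ∉ C → ¬ G.Adj i j := by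
  obtain ⟨C, hvC, hC⟩ := Finite.exists_le_maximal (a := {v})
    (p := fun C : Set V ↦ C ⊆ s ∧ (G.induce C).Connected)
    ⟨by simpa, SimpleGraph.Connected.mk (by
      rintro ⟨x, rfl⟩ ⟨y, rfl⟩
      rfl)⟩
  refine ⟨C, hC.prop.1, hvC rfl, hC.prop.2, fun i hi j hj hjC hadj ↦ hjC ?_⟩
  -- An edge from `C` to `j` would allow the maximal connected set `C` to be enlarged.
  refine hC.2 (y := C ∪ {i, j}) ⟨?_, ?_⟩ Set.subset_union_left (by simp)
  · simp [Set.insert_subset_iff, hC.prop.1, hC.prop.1 hi, hj]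
  · exact SimpleGraph.induce_union_connected hC.prop.2.preconnected
      (SimpleGraph.induce_pair_connected_of_adj hadj).preconnected ⟨i, hi, by simp⟩

/-- Every element of the Weyl group is the product of pairwise independent elements with connected
influence. -/
lemma exists_factorization (b : P.Base) (σ : P.weylGroup) :
    ∃ L : List P.weylGroup, L.Nodup ∧ (∀ τ ∈ L, HasConnectedInfluence b τ) ∧
      PairwiseIndependent b {τ | τ ∈ L} ∧ L.prod = σ := by
  -- Split off the factor supported on one component `C`; the cofactor has strictly smaller
  -- influence.
  induction hn : (influence b σ).ncard using Nat.strong_induction_on generalizing σ with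
  | h n ih =>
    obtain hσ | ⟨i, hi⟩ := (influence b σ).eq_empty_or_nonempty
    · exact ⟨[], List.nodup_nil, by simp, by simp [PairwiseIndependent],
        (influence_eq_empty_iff.1 hσ).symm⟩
    obtain ⟨C, hCσ, hiC, hC, hadj⟩ := (dynkinGraph b).exists_connected_subset_not_adj hi
    have horth {i j : b.support} (hi : i ∈ C) (hj : j ∈ influence b σ \ C) :
        i ≠ j ∧ P.IsOrthogonal i j := by
      have hij : i ≠ j := fun e ↦ hj.2 (e ▸ hi)
      exact ⟨hij, by_contra fun h ↦ hadj i hi j hj.1 hj.2 ⟨hij, h⟩⟩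
    obtain ⟨σ₁, σ₂, hprod, h₁, h₂⟩ := exists_mul_eq_of_isOrthogonal σ C
      fun i _ hi j hj hj' ↦ (horth hi ⟨hj, hj'⟩).2
    rw [Set.inter_eq_right.2 hCσ] at h₁
    obtain ⟨L, hL, hconn, hind, rfl⟩ := ih _
      (hn ▸ h₂ ▸ Set.ncard_lt_ncard ⟨Set.sdiff_subset, fun h ↦ (h hi).2 hiC⟩) σ₂ rfl
    have hsub {τ : P.weylGroup} (hτ : τ ∈ L) {j : b.support} (hj : j ∈ influence b τ) :
        j ∈ influence b σ \ C := h₂ ▸ (influence_list_prod hL hind j).2 ⟨τ, hτ, hj⟩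
    refine ⟨σ₁ :: L, List.nodup_cons.2 ⟨fun hmem ↦ ?_, hL⟩, ?_, ?_, by simpa⟩
    · exact (hsub hmem (h₁ ▸ hiC)).2 hiC
    · rintro τ (_ | ⟨_, hτ⟩)
      · rwa [HasConnectedInfluence, h₁]
      · exact hconn τ hτ
    · have key {τ : P.weylGroup} (hτ : τ ∈ L) {i j : b.support} (hi : i ∈ influence b σ₁)
          (hj : j ∈ influence b τ) := horth (h₁ ▸ hi) (hsub hτ hj)
      rintro τ (_ | ⟨_, hτ⟩) τ' (_ | ⟨_, hτ'⟩) hne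
      · exact absurd rfl hne
      · exact independent_iff.2 fun i hi j hj ↦ key hτ' hi hj
      · exact independent_iff.2 fun i hi j hj ↦
          ⟨(key hτ hj hi).1.symm, (key hτ hj hi).2.symm⟩
      · exact hind τ hτ τ' hτ' hne

lemma HasConnectedInfluence.ne_one {σ : P.weylGroup} (h : HasConnectedInfluence b σ) :
    σ ≠ 1 := by
  rintro rfl
  obtain ⟨i, hi⟩ := h.nonempty
  simp at hi

/-- An element with connected influence is not a product of two nontrivial independent elements. -/
lemma HasConnectedInfluence.eq_one_of_independent {σ τ : P.weylGroup}
    (h : HasConnectedInfluence b (σ * τ)) (hind : Independent b σ τ) (hσ : σ ≠ 1) : τ = 1 := by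
  by_contra hτ
  rw [ne_eq, ← influence_eq_empty_iff (b := b), ← ne_eq, ← Set.nonempty_iff_ne_empty] at hσ
  rw [← influence_eq_empty_iff (b := b), ← ne_eq, ← Set.nonempty_iff_ne_empty] at hτ
  obtain ⟨i, hi⟩ := hσ
  obtain ⟨j, hj⟩ := hτ
  have hunion := hind.influence_mul
  have hi' : i ∈ influence b (σ * τ) := hunion ▸ Or.inl hi
  have hj' : j ∈ influence b (σ * τ) := hunion ▸ Or.inr hj
  rw [independent_iff] at hind
  obtain ⟨p⟩ := h.preconnected ⟨i, hi'⟩ ⟨j, hj'⟩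
  -- A path from `I(σ)` to `I(τ)` inside their union crosses an edge between them, which
  -- independence forbids.
  obtain ⟨d, -, hd, hd'⟩ := p.exists_boundary_dart {k | (k : b.support) ∈ influence b σ} hi
    fun h ↦ (hind j h j hj).1 rfl
  have : (d.snd : b.support) ∈ influence b τ := (hunion.le d.snd.2).resolve_left hd'
  exact d.adj.2 (hind _ hd _ this).2

end WeylAlternation

namespace WeylAlternation

variable {ι M N : Type*} [AddCommGroup M] [Module ℂ M] [AddCommGroup N] [Module ℂ N]
  {P : RootPairing ι ℂ M N} [Fintype ι] [P.IsRootSystem] [P.IsCrystallographic] {b : P.Base}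

/-! ### Weyl alternation sets -/

/-- Positive roots are natural combinations of simple roots, and simple roots are themselves
positive. -/
lemma kostant_pos_iff {x : M} : 0 < kostant b x ↔ HasNatCoeffs b x := by
  classical
  rw [kostant, pos_iff_ne_zero, ne_eq, ENat.card_eq_zero_iff_empty, not_isEmpty_iff,
    nonempty_subtype]
  constructor
  · rintro ⟨c, rfl⟩
    exact Finset.sum_induction _ (HasNatCoeffs b) (fun _ _ ↦ HasNatCoeffs.add)
      (HasNatCoeffs.zero b) fun i _ ↦ (hasNatCoeffs_root i.2).nsmul _
  · intro hx
    choose n hn using hx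
    refine ⟨∑ k, n k • Pi.single ⟨k, b.isPos_of_mem_support k.2⟩ 1, ?_⟩
    have hsum (k : b.support) : ∑ i : {i : ι // b.IsPos i},
        (Pi.single ⟨k, b.isPos_of_mem_support k.2⟩ 1 : {i : ι // b.IsPos i} → ℕ) i • P.root i =
          P.root k := by
      rw [Finset.sum_eq_single ⟨k, b.isPos_of_mem_support k.2⟩] <;> simp +contextual
    rw [← b.toWeightBasis.sum_repr x]
    simp_rw [Finset.sum_apply, Finset.sum_smul, Pi.smul_apply, smul_eq_mul, mul_smul]
    rw [Finset.sum_comm]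
    simp_rw [← Finset.smul_sum, hsum, hn, b.toWeightBasis_apply, Nat.cast_smul_eq_nsmul]

lemma mem_altSet_iff {lam mu : M} {σ : P.weylGroup} :
    σ ∈ altSet b lam mu ↔ HasNatCoeffs b (σ • (lam + rho b) - mu - rho b) :=
  kostant_pos_iff

lemma hasIntCoeffs_of_mem_rootLattice (b : P.Base) {x : M} (hx : x ∈ rootLattice P) :
    HasIntCoeffs b x := by
  refine AddSubgroup.closure_induction ?_ (HasNatCoeffs.zero b).hasIntCoeffs ?_ ?_ hx
  · rintro _ ⟨i, rfl⟩
    let := P.indexNeg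
    rcases RootPairing.Base.IsPos.or_neg b i with hi | hi
    · exact (hasNatCoeffs_root hi).hasIntCoeffs
    · simpa using (HasNatCoeffs.zero b).hasIntCoeffs.sub (hasNatCoeffs_root hi).hasIntCoeffs
  · intro x y _ _ hx hy
    simpa using hx.sub ((HasNatCoeffs.zero b).hasIntCoeffs.sub hy)
  · intro x _ hx
    simpa using (HasNatCoeffs.zero b).hasIntCoeffs.sub hx

/-- The order only gives nonnegative real coefficients; integrality upgrades them to natural
numbers. -/
lemma LowerEq.hasNatCoeffs {x y : M} (h : LowerEq b x y) (hint : HasIntCoeffs b (y - x)) :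
    HasNatCoeffs b (y - x) := fun k ↦ by
  classical
  obtain ⟨c, hc₀, hc⟩ := h
  obtain ⟨z, hz⟩ := hint k
  choose n hn using fun i : {i : ι // b.IsPos i} ↦ hasNatCoeffs_root i.2 k
  have hzc : (z : ℂ) = ((∑ i, c i * n i : ℝ) : ℂ) := by
    rw [← hz, hc]
    simp [hn, -Complex.coe_smul]
  have hz₀ : 0 ≤ (z : ℝ) := by
    rw [show (z : ℝ) = ∑ i, c i * n i by exact_mod_cast hzc]
    exact Finset.sum_nonneg fun i _ ↦ mul_nonneg (hc₀ i) (n i).cast_nonneg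
  lift z to ℕ using by exact_mod_cast hz₀
  exact ⟨z, by simpa using hz⟩

variable [P.IsReduced]

lemma altSet_subset_of_lowerEq {lam mu nu : M} (hlam : IsStrictlyDominant b (lam + rho b))
    (hle : LowerEq b nu mu) (h : mu - nu ∈ rootLattice P ∨ (altSet b lam nu).Nonempty) :
    altSet b lam mu ⊆ altSet b lam nu := by
  intro σ hσ
  rw [mem_altSet_iff] at hσ ⊢
  have hint : HasIntCoeffs b (mu - nu) := by
    rcases h with h | ⟨τ, hτ⟩
    · exact hasIntCoeffs_of_mem_rootLattice b h
    · rw [mem_altSet_iff] at hτ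
      -- With `x = lam + rho b`, this is `mu - nu = (τx - nu - ρ) - (σx - mu - ρ) - (x - σx) + (x -
      -- τx)`.
      convert ((hτ.hasIntCoeffs.sub hσ.hasIntCoeffs).sub
        (hasNatCoeffs_displacement hlam σ).hasIntCoeffs).sub
        ((HasNatCoeffs.zero b).hasIntCoeffs.sub (hasNatCoeffs_displacement hlam τ).hasIntCoeffs)
        using 1
      abel
  convert hσ.add (hle.hasNatCoeffs hint) using 1
  abel

/-- By additivity, dropping a factor adds its displacement, which has natural coefficients, to the
weight being partitioned. -/
lemma Independent.mem_altSet_of_mul_mem {lam mu : M} {σ τ : P.weylGroup}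
    (h : Independent b σ τ) (hlam : IsStrictlyDominant b (lam + rho b))
    (hmem : σ * τ ∈ altSet b lam mu) : σ ∈ altSet b lam mu ∧ τ ∈ altSet b lam mu := by
  simp only [mem_altSet_iff] at hmem ⊢
  have hadd := h.displacement_mul hlam
  constructor
  · convert hmem.add (hasNatCoeffs_displacement hlam τ) using 1
    rw [← sub_eq_iff_eq_add'.2 hadd]
    abel
  · convert hmem.add (hasNatCoeffs_displacement hlam σ) using 1
    rw [← sub_eq_iff_eq_add.2 hadd]
    abel

lemma mem_altSet_of_mem_of_list_prod_mem {lam mu : M} {L : List P.weylGroup} (hL : L.Nodup)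
    (hind : PairwiseIndependent b {τ | τ ∈ L}) (hlam : IsStrictlyDominant b (lam + rho b))
    (hmem : L.prod ∈ altSet b lam mu) : ∀ τ ∈ L, τ ∈ altSet b lam mu := by
  induction L with
  | nil => simp
  | cons σ L ih =>
    rw [List.prod_cons] at hmem
    obtain ⟨h₁, h₂⟩ := (independent_list_prod hL hind).mem_altSet_of_mul_mem hlam hmem
    rintro τ (_ | ⟨_, hτ⟩)
    · exact h₁
    · exact ih (List.nodup_cons.1 hL).2 hind.of_cons h₂ τ hτ

/-! ### Basic allowable subwords -/

lemma isBAS_setOf_hasConnectedInfluence {lam : M} (hlam : IsStrictlyDominant b (lam + rho b))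
    (mu : M) : IsBAS b lam mu {σ ∈ altSet b lam mu | HasConnectedInfluence b σ} where
  subset _ hσ := hσ.1
  one_notMem h := h.2.ne_one rfl
  connected _ hσ := hσ.2
  exists_prod σ hσ := by
    obtain ⟨L, hL, hconn, hind, rfl⟩ := exists_factorization b σ
    exact ⟨L, hL, fun τ hτ ↦
      ⟨mem_altSet_of_mem_of_list_prod_mem hL hind hlam hσ τ hτ, hconn τ hτ⟩, hind, rfl⟩

lemma IsBAS.eq_setOf_hasConnectedInfluence {lam mu : M} {S : Set P.weylGroup}
    (hS : IsBAS b lam mu S) : S = {σ ∈ altSet b lam mu | HasConnectedInfluence b σ} := by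
  refine Set.Subset.antisymm (fun σ hσ ↦ ⟨hS.subset hσ, hS.connected σ hσ⟩) fun σ hσ ↦ ?_
  obtain ⟨L, hL, hLS, hind, rfl⟩ := hS.exists_prod σ hσ.1
  cases L with
  | nil => exact absurd rfl hσ.2.ne_one
  | cons τ L =>
    have hτ := hLS τ List.mem_cons_self
    have h := independent_list_prod hL hind
    rw [List.prod_cons] at hσ ⊢
    -- The head `τ ∈ S` is nontrivial and independent of the remaining product, so connectedness
    -- makes the latter trivial and the whole product equals `τ`.
    rwa [hσ.2.eq_one_of_independent h (hS.connected τ hτ).ne_one, mul_one]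

lemma existsUnique_isBAS {lam : M} (hlam : IsStrictlyDominant b (lam + rho b)) (mu : M) :
    ∃! S, IsBAS b lam mu S :=
  ⟨_, isBAS_setOf_hasConnectedInfluence hlam mu, fun _ h ↦ h.eq_setOf_hasConnectedInfluence⟩

lemma BAS_eq {lam : M} (hlam : IsStrictlyDominant b (lam + rho b)) (mu : M) :
    BAS b lam mu = {σ ∈ altSet b lam mu | HasConnectedInfluence b σ} := by
  have h := existsUnique_isBAS hlam mu
  rw [BAS, dif_pos h]
  exact IsBAS.eq_setOf_hasConnectedInfluence h.choose_spec.1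

end WeylAlternation

theorem mainTheorem4 {𝔤 : Type*} [LieRing 𝔤] [LieAlgebra ℂ 𝔤] [FiniteDimensional ℂ 𝔤]
    [LieAlgebra.IsSimple ℂ 𝔤] (H : LieSubalgebra ℂ 𝔤) [H.IsCartanSubalgebra]
    (b : (LieAlgebra.IsKilling.rootSystem H).Base) (lam mu nu : Module.Dual ℂ H)
    (hlam : WeylAlternation.IsIntegral (LieAlgebra.IsKilling.rootSystem H) lam)
    (hdom : WeylAlternation.IsDominant b lam)
    (hmu : WeylAlternation.IsIntegral (LieAlgebra.IsKilling.rootSystem H) mu)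
    (hnu : WeylAlternation.IsIntegral (LieAlgebra.IsKilling.rootSystem H) nu)
    (hle : WeylAlternation.LowerEq b nu mu)
    (hdef : mu - nu ∈ WeylAlternation.rootLattice (LieAlgebra.IsKilling.rootSystem H) ∨
      (WeylAlternation.altSet b lam nu).Nonempty) :
    (∃! S, WeylAlternation.IsBAS b lam mu S) ∧
    (∃! S, WeylAlternation.IsBAS b lam nu S) ∧
    WeylAlternation.BAS b lam mu =
      WeylAlternation.BAS b lam nu ∩ WeylAlternation.altSet b lam mu := by
  have hreg := WeylAlternation.isStrictlyDominant_add_rho hlam hdom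
  refine ⟨WeylAlternation.existsUnique_isBAS hreg mu, WeylAlternation.existsUnique_isBAS hreg nu, ?_⟩
  have hsub := WeylAlternation.altSet_subset_of_lowerEq hreg hle hdef
  rw [WeylAlternation.BAS_eq hreg, WeylAlternation.BAS_eq hreg]
  ext σ
  exact ⟨fun h ↦ ⟨⟨hsub h.1, h.2⟩, h.1⟩, fun h ↦ ⟨h.2, h.1.2⟩⟩
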